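/- There are absolute constants $c_1,c_2>0$ such that the following holds for every prime power $q$. Let $Q(4,q)$ be the incidence structure whose points are the points of $\mathrm{PG}(4,q)$ on the parabolic quadric $X_0^2+X_1X_2+X_3X_4=0$, and whose lines are the lines of $\mathrm{PG}(4,q)$ contained in this quadric. Its adjacency graph has the points of $Q(4,q)$ as vertices, two distinct points being adjacent when they lie on a common line of $Q(4,q)$; let $n$ be the number of vertices. An identifying code of a graph is a set $C$ of vertices such that, writing $N[u]$ for the closed neighbourhood of $u$, the set $N[u]\cap C$ is nonempty for every vertex $u$, and $N[u]\cap C\neq N[v]\cap C$ for all distinct vertices $u,v$. Then $Q(4,q)$ is a generalized quadrangle $\mathrm{GQ}(q,q)$: two distinct points are on at most one common line, each line has $q+1$ points, each point is on $q+1$ lines, and for a point $P$ not on a line $L$ there is exactly one line through $P$ that meets $L$. Moreover, its adjacency graph has an identifying code $C$ of size $$|C|=5q-2,\qquad c_1 n^{1/3}\le 5q-2\le c_2 n^{1/3},$$ so that $|C|=\Theta(n^{1/3})$. The code has the following form: there are a hyperplane $\pi$ of $\mathrm{PG}(4,q)$ that meets the quadric in a hyperbolic quadric $Q^+(3,q)$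 (given by $Y_0Y_1+Y_2Y_3=0$ in suitable coordinates of $\pi$), three pairwise disjoint lines $\ell_0,\ell_1,\ell_2$ of $Q(4,q)$ contained in $\pi$, two distinct points $P_1,P_2$ of $\ell_2$, and lines $M_1\ni P_1$, $M_2\ni P_2$ of $Q(4,q)$ not contained in $\pi$, such that $C$ is obtained from $\ell_0\cup\ell_1\cup\ell_2\cup M_1\cup M_2$ by removing one point of each of the five lines, none of the removed points being $P_1$ or $P_2$. -/

import Mathlib

universe u v w

namespace GQCode

/-- The closed neighbourhood `N[u]` of a vertex. -/
def closedNbhd {V : Type u} (G : SimpleGraph V) (x : V) : Set V :=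
  {y | y = x ∨ G.Adj x y}

/-- An identifying code: a set of vertices that is dominating (it meets every closed
neighbourhood) and separating (distinct vertices `x`, `y` have distinct sets
`N[x] ∩ C` and `N[y] ∩ C`). -/
def IsIdentifyingCode {V : Type u} (G : SimpleGraph V) (C : Set V) : Prop :=
  (∀ x, (closedNbhd G x ∩ C).Nonempty) ∧
    ∀ x y, x ≠ y → closedNbhd G x ∩ C ≠ closedNbhd G y ∩ C

/-- A generalized quadrangle `GQ(s,t)`, given by an incidence relation between points and
lines. -/
structure IsGQ {P : Type v} {L : Type w} (inc : P → L → Prop) (s t : ℕ) : Prop where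
  s_pos : 0 < s
  t_pos : 0 < t
  /-- Two distinct points are on at most one common line. -/
  line_unique : ∀ (p r : P) (l m : L), p ≠ r → inc p l → inc r l → inc p m → inc r m → l = m
  /-- There are `s + 1` points on each line. -/
  points_on_line : ∀ l : L, {p : P | inc p l}.ncard = s + 1
  /-- There are `t + 1` lines through each point. -/
  lines_through_point : ∀ p : P, {l : L | inc p l}.ncard = t + 1
  /-- If `p` is not on `l`, exactly one line through `p` meets `l`. -/
  projection : ∀ (p : P) (l : L), ¬ inc p l → ∃! m : L, inc p m ∧ ∃ r : P, inc r m ∧ inc r l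

/-- The adjacency graph of an incidence structure: the vertices are the points, and two distinct
points are adjacent if they belong to a common line. -/
def adjacencyGraph {P : Type v} {L : Type w} (inc : P → L → Prop) : SimpleGraph P where
  Adj p r := p ≠ r ∧ ∃ l, inc p l ∧ inc r l
  symm := ⟨fun _ _ h => ⟨h.1.symm, h.2.imp fun _ hl => ⟨hl.2, hl.1⟩⟩⟩
  loopless := ⟨fun _ h => h.1 rfl⟩

section

variable (F : Type u) [Field F]

/-- The form `X₀² + X₁X₂ + X₃X₄` on `F⁵`. -/
def parabolicForm : QuadraticForm F (Fin 5 → F) :=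
  QuadraticMap.proj 0 0 + QuadraticMap.proj 1 2 + QuadraticMap.proj 3 4

theorem parabolicForm_apply (x : Fin 5 → F) :
    parabolicForm F x = x 0 ^ 2 + x 1 * x 2 + x 3 * x 4 := by
  simp [parabolicForm, pow_two]

/-- The form `Y₀Y₁ + Y₂Y₃` on `F⁴`, whose zeros in `PG(3,F)` form the hyperbolic quadric. -/
def hyperbolicForm : QuadraticForm F (Fin 4 → F) :=
  QuadraticMap.proj 0 1 + QuadraticMap.proj 2 3

theorem hyperbolicForm_apply (y : Fin 4 → F) :
    hyperbolicForm F y = y 0 * y 1 + y 2 * y 3 := by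
  simp [hyperbolicForm]

/-- The points of `Q(4,F)`: the points of `PG(4,F)` on which the parabolic form vanishes. -/
def QPoint : Type u :=
  {p : Projectivization F (Fin 5 → F) // ∀ x ∈ p.submodule, parabolicForm F x = 0}

/-- The lines of `Q(4,F)`: the lines of `PG(4,F)` (two-dimensional linear subspaces of `F⁵`) all
of whose points are on the quadric. -/
def QLine : Type u :=
  {l : Submodule F (Fin 5 → F) // Module.finrank F l = 2 ∧ ∀ x ∈ l, parabolicForm F x = 0}

variable {F}

/-- Incidence of `Q(4,F)`: the point lies on the line. -/
def QInc (p : QPoint F) (l : QLine F) : Prop := p.1.submodule ≤ l.1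

/-- The set of points of a line of `Q(4,F)`. -/
def QLine.points (l : QLine F) : Set (QPoint F) := {p | QInc p l}

/-- The line lies in the projective subspace with underlying linear subspace `W`. -/
def QLine.IsIn (l : QLine F) (W : Submodule F (Fin 5 → F)) : Prop := l.1 ≤ W

/-- `W` is a hyperplane `PG(3,F)` of `PG(4,F)` that meets `Q(4,F)` in a hyperbolic quadric
`Q⁺(3,F)`: in suitable linear coordinates on `W` the form becomes `Y₀Y₁ + Y₂Y₃`. -/
def IsHyperbolicHyperplane (W : Submodule F (Fin 5 → F)) : Prop :=
  Module.finrank F W = 4 ∧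
    QuadraticMap.Equivalent ((parabolicForm F).comp W.subtype) (hyperbolicForm F)

end

end GQCode

namespace GQCode

/-! ### Consequences of the axioms of a generalized quadrangle -/

section IsGQ

variable {P : Type v} {L : Type w} {inc : P → L → Prop} {s t : ℕ}

/-! In a generalized quadrangle every point `x` is collinear with a point of each line `l`, and with
only one if `x` is off `l`; call it the projection of `x` onto `l`. Each of the five lines loses
just one point in the code, so for q ≥ 2 the trace N[x] ∩ C tells whether `x` is on the line and, by
elimination, recovers the projection when it does not (`mem_line_of_trace_eq`,
`exists_common_collinear_of_trace_eq`).

Suppose distinct `x`, `y` have the same trace. Then neither is on ℓ₀, ℓ₁, ℓ₂, and they have common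
projections onto all five lines. If `x` and `y` are collinear, the common projections lie on the
line xy, which meets ℓ₀ and ℓ₁ in distinct points and so lies in the hyperplane. Otherwise the
projections onto ℓ₀, ℓ₁, ℓ₂ either lie on a transversal, which would make `x` and `y` collinear, or
determine `y` up to the sign of X₀: `y` is the reflection of `x` in X₀ = 0, and whatever is
collinear with both has X₀ = 0 (`zero_coord_of_common_collinear`). In each case the projections onto
M₁ and M₂ are in the hyperplane, hence are P₁ and P₂. Then `x` is off ℓ₂ but collinear with two of
its points, a contradiction.

Domination depends on which points are removed: those of ℓ₀ and ℓ₁ lie on a line `n` through P₁. A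
point whose trace is empty projects to both, so it is on `n` and is collinear with P₁, which is in
the code.

The quadrangle axioms rest on totally singular subspaces having dimension at most two
(`finrank_le_two_of_totally_singular`), in a form valid in characteristic 2, where the polar form is
degenerate. -/

theorem ncard_biUnion_le_mul {α β : Type*} [Finite α] (S : Set α) (f : α → Set β)
    (n : ℕ) (h : ∀ a ∈ S, (f a).ncard ≤ n) :
    (⋃ a ∈ S, f a).ncard ≤ S.ncard * n := by
  induction S, S.toFinite using Set.Finite.induction_on with
  | empty => simp
  | @insert a S ha hS ih =>
    rw [Set.biUnion_insert, Set.ncard_insert_of_notMem ha hS, add_mul, one_mul, add_comm]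
    refine (Set.ncard_union_le _ _).trans (add_le_add (h a (Set.mem_insert _ _)) ?_)
    exact ih fun b hb => h b (Set.mem_insert_of_mem _ hb)

namespace IsGQ

/-- Every point lies on a line that meets `l`. The resulting cover counts points with multiplicity,
but the bound has the right order of magnitude. -/
theorem card_points_le [Finite P] [Finite L] (hG : IsGQ inc s t) (l : L) :
    Nat.card P ≤ (s + 1) * ((t + 1) * (s + 1)) := by
  have hcover : (Set.univ : Set P) ⊆
      ⋃ r ∈ {r | inc r l}, ⋃ m ∈ {m | inc r m}, {p | inc p m} := by
    intro p _
    simp only [Set.mem_iUnion, Set.mem_ofPred_eq, exists_prop]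
    by_cases hp : inc p l
    · exact ⟨p, hp, l, hp, hp⟩
    · obtain ⟨m, ⟨hpm, r, hrm, hrl⟩, -⟩ := hG.projection p l hp
      exact ⟨r, hrl, m, hrm, hpm⟩
  rw [← Set.ncard_univ]
  refine (Set.ncard_le_ncard hcover (Set.toFinite _)).trans ?_
  rw [← hG.points_on_line l]
  refine ncard_biUnion_le_mul _ _ _ fun r _ => ?_
  rw [hG.points_on_line l, ← hG.lines_through_point r]
  exact ncard_biUnion_le_mul _ _ _ fun m _ => (hG.points_on_line m).le

/-- A point off a line is collinear with at most one point of the line. -/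
theorem eq_of_collinear (hG : IsGQ inc s t) {p r r' : P} {l : L} (hp : ¬ inc p l)
    (hr : inc r l) (hr' : inc r' l) (h : ∃ m, inc p m ∧ inc r m) (h' : ∃ m, inc p m ∧ inc r' m) :
    r = r' := by
  obtain ⟨m, hpm, hrm⟩ := h
  obtain ⟨m', hpm', hrm'⟩ := h'
  obtain rfl := (hG.projection p l hp).unique ⟨hpm, r, hrm, hr⟩ ⟨hpm', r', hrm', hr'⟩
  by_contra hne
  exact hp (hG.line_unique r r' l m hne hr hr' hrm hrm' ▸ hpm)

/-- Every point is collinear with some point of any given line. -/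
theorem exists_collinear (hG : IsGQ inc s t) (p : P) (l : L) :
    ∃ r, inc r l ∧ ∃ m, inc p m ∧ inc r m := by
  by_cases hp : inc p l
  · exact ⟨p, hp, l, hp, hp⟩
  · obtain ⟨m, ⟨hpm, r, hrm, hrl⟩, -⟩ := hG.projection p l hp
    exact ⟨r, hrl, m, hpm, hrm⟩

theorem mem_closedNbhd_iff (hG : IsGQ inc s t) {x y : P} :
    y ∈ closedNbhd (adjacencyGraph inc) x ↔ ∃ l, inc x l ∧ inc y l := by
  refine ⟨?_, fun h => ?_⟩
  · rintro (rfl | ⟨-, h⟩)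
    -- The case of equal points needs some line through the point.
    · have hne : {l : L | inc y l}.ncard ≠ 0 := by rw [hG.lines_through_point]; omega
      obtain ⟨l, hl⟩ := Set.nonempty_of_ncard_ne_zero hne
      exact ⟨l, hl, hl⟩
    · exact h
  · by_cases hxy : y = x
    · exact Or.inl hxy
    · exact Or.inr ⟨Ne.symm hxy, h⟩

theorem exists_pair_of_two_le (hG : IsGQ inc s t) (hs : 2 ≤ s) (l : L) (a : P) :
    ∃ r r', r ≠ r' ∧ inc r l ∧ inc r' l ∧ r ≠ a ∧ r' ≠ a := by
  have hfin : {p | inc p l}.Finite :=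
    Set.finite_of_ncard_ne_zero (by rw [hG.points_on_line]; omega)
  have hcard : 1 < ({p | inc p l} \ {a}).ncard := by
    have := Set.le_ncard_sdiff {a} {p | inc p l}
    rw [Set.ncard_singleton, hG.points_on_line] at this
    omega
  obtain ⟨r, hr, r', hr', hne⟩ := (Set.one_lt_ncard (hfin.subset Set.sdiff_subset)).1 hcard
  exact ⟨r, r', hne, hr.1, hr'.1, hr.2, hr'.2⟩

variable {C : Set P} {x y a : P} {l : L}

/-- A line with at most one point missing from a code detects which points belong to it. -/
theorem mem_line_of_trace_eq (hG : IsGQ inc s t) (hs : 2 ≤ s)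
    (hC : ∀ r, inc r l → r ≠ a → r ∈ C)
    (h : closedNbhd (adjacencyGraph inc) x ∩ C = closedNbhd (adjacencyGraph inc) y ∩ C)
    (hx : inc x l) : inc y l := by
  obtain ⟨r, r', hne, hr, hr', hra, hra'⟩ := hG.exists_pair_of_two_le hs l a
  have key : ∀ z, inc z l → z ≠ a → ∃ m, inc y m ∧ inc z m := fun z hz hza => by
    have hz' : z ∈ closedNbhd (adjacencyGraph inc) x ∩ C :=
      ⟨hG.mem_closedNbhd_iff.2 ⟨l, hx, hz⟩, hC z hz hza⟩
    exact hG.mem_closedNbhd_iff.1 (h ▸ hz').1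
  by_contra hy
  exact hne (hG.eq_of_collinear hy hr hr' (key r hr hra) (key r' hr' hra'))

/-- A line with at most one point missing from a code determines the projections onto it. -/
theorem exists_common_collinear_of_trace_eq (hG : IsGQ inc s t)
    (hC : ∀ r, inc r l → r ≠ a → r ∈ C)
    (h : closedNbhd (adjacencyGraph inc) x ∩ C = closedNbhd (adjacencyGraph inc) y ∩ C) :
    ∃ r, inc r l ∧ (∃ m, inc x m ∧ inc r m) ∧ ∃ m, inc y m ∧ inc r m := by
  obtain ⟨r, hr, hxr⟩ := hG.exists_collinear x l
  obtain ⟨r', hr', hyr'⟩ := hG.exists_collinear y l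
  -- A projection other than the missing point `a` is visible in the common trace; if neither is
  -- visible, both equal `a`.
  by_cases hra : r = a
  · by_cases hra' : r' = a
    · exact ⟨r, hr, hxr, by rwa [hra, ← hra']⟩
    · have : r' ∈ closedNbhd (adjacencyGraph inc) x ∩ C :=
        h ▸ ⟨hG.mem_closedNbhd_iff.2 hyr', hC r' hr' hra'⟩
      exact ⟨r', hr', hG.mem_closedNbhd_iff.1 this.1, hyr'⟩
  · have : r ∈ closedNbhd (adjacencyGraph inc) y ∩ C :=
      h ▸ ⟨hG.mem_closedNbhd_iff.2 hxr, hC r hr hra⟩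
    exact ⟨r, hr, hxr, hG.mem_closedNbhd_iff.1 this.1⟩

end IsGQ

end IsGQ

/-! ### Points, lines and the polar form of the parabolic quadric -/

section Quadric

variable {F : Type u} [Field F]

/-- The polar form of the parabolic form. -/
def polarForm : LinearMap.BilinForm F (Fin 5 → F) := QuadraticMap.polarBilin (parabolicForm F)

theorem polarForm_apply (x y : Fin 5 → F) :
    polarForm x y = 2 * x 0 * y 0 + x 1 * y 2 + x 2 * y 1 + x 3 * y 4 + x 4 * y 3 := by
  simp only [polarForm, QuadraticMap.polarBilin_apply_apply, QuadraticMap.polar,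
    parabolicForm_apply, Pi.add_apply]
  ring

theorem polarForm_comm (x y : Fin 5 → F) : polarForm x y = polarForm y x := by
  rw [polarForm_apply, polarForm_apply]; ring

theorem parabolicForm_add (x y : Fin 5 → F) :
    parabolicForm F (x + y) = parabolicForm F x + parabolicForm F y + polarForm x y := by
  simp only [polarForm_apply, parabolicForm_apply, Pi.add_apply]; ring

theorem parabolicForm_smul (c : F) (x : Fin 5 → F) :
    parabolicForm F (c • x) = c ^ 2 * parabolicForm F x := by
  simp only [parabolicForm_apply, Pi.smul_apply, smul_eq_mul]; ring

/-- The point of the quadric spanned by a singular vector. -/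
def mkPoint (x : Fin 5 → F) (hx : x ≠ 0) (hq : parabolicForm F x = 0) : QPoint F :=
  ⟨Projectivization.mk F x hx, by
    intro y hy
    rw [Projectivization.submodule_mk, Submodule.mem_span_singleton] at hy
    obtain ⟨c, rfl⟩ := hy
    rw [parabolicForm_smul, hq, mul_zero]⟩

/-- A singular vector representing a point of the quadric. -/
noncomputable def QPoint.vec (p : QPoint F) : Fin 5 → F := p.1.rep

theorem QPoint.submodule_eq (p : QPoint F) : p.1.submodule = Submodule.span F {p.vec} :=
  p.1.submodule_eq

theorem QPoint.vec_ne_zero (p : QPoint F) : p.vec ≠ 0 := p.1.rep_nonzero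

theorem QPoint.parabolicForm_vec (p : QPoint F) : parabolicForm F p.vec = 0 :=
  p.2 _ (p.submodule_eq ▸ Submodule.mem_span_singleton_self _)

theorem qInc_iff {p : QPoint F} {l : QLine F} : QInc p l ↔ p.vec ∈ l.1 := by
  rw [QInc, p.submodule_eq, Submodule.span_singleton_le_iff_mem]

theorem QPoint.ext_of_smul {p r : QPoint F} {c : F} (h : r.vec = c • p.vec) : p = r := by
  apply Subtype.ext
  rw [← p.1.mk_rep, ← r.1.mk_rep, eq_comm, Projectivization.mk_eq_mk_iff']
  exact ⟨c, h.symm⟩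

theorem vec_mkPoint (x : Fin 5 → F) (hx : x ≠ 0) (hq : parabolicForm F x = 0) :
    ∃ c : F, c ≠ 0 ∧ (mkPoint x hx hq).vec = c • x := by
  obtain ⟨a, ha⟩ := Projectivization.exists_smul_eq_mk_rep F x hx
  exact ⟨a, a.ne_zero, ha.symm⟩

theorem qInc_mkPoint {x : Fin 5 → F} (hx : x ≠ 0) (hq : parabolicForm F x = 0) {l : QLine F} :
    QInc (mkPoint x hx hq) l ↔ x ∈ l.1 := by
  obtain ⟨c, hc, h⟩ := vec_mkPoint x hx hq
  rw [qInc_iff, h, Submodule.smul_mem_iff _ hc]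

theorem mkPoint_eq_iff {x y : Fin 5 → F} (hx : x ≠ 0) (hq : parabolicForm F x = 0)
    (hy : y ≠ 0) (hq' : parabolicForm F y = 0) :
    mkPoint x hx hq = mkPoint y hy hq' ↔ ∃ c : F, c • y = x := by
  rw [← Projectivization.mk_eq_mk_iff' F x y hx hy]
  exact Subtype.ext_iff

theorem polarForm_eq_zero_of_qInc {p r : QPoint F} {l : QLine F} (hp : QInc p l)
    (hr : QInc r l) : polarForm p.vec r.vec = 0 := by
  have h := l.2.2 _ (l.1.add_mem (qInc_iff.1 hp) (qInc_iff.1 hr))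
  rwa [parabolicForm_add, p.parabolicForm_vec, r.parabolicForm_vec, zero_add, zero_add] at h

theorem linearIndependent_vec {p r : QPoint F} (h : p ≠ r) :
    LinearIndependent F ![p.vec, r.vec] := by
  rw [LinearIndependent.pair_iff' p.vec_ne_zero]
  exact fun c hc => h (QPoint.ext_of_smul hc.symm)

theorem finrank_span_pair {x y : Fin 5 → F} (h : LinearIndependent F ![x, y]) :
    Module.finrank F (Submodule.span F {x, y}) = 2 := by
  have := finrank_span_eq_card h
  rwa [Matrix.range_cons, Matrix.range_cons, Matrix.range_empty, Set.union_empty,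
    Set.singleton_union, Fintype.card_fin] at this

/-- The line of the quadric spanned by two orthogonal singular vectors. -/
def mkLine (x y : Fin 5 → F) (h : LinearIndependent F ![x, y]) (hx : parabolicForm F x = 0)
    (hy : parabolicForm F y = 0) (hxy : polarForm x y = 0) : QLine F :=
  ⟨Submodule.span F {x, y}, finrank_span_pair h, by
    intro z hz
    obtain ⟨a, b, rfl⟩ := Submodule.mem_span_pair.1 hz
    simp [parabolicForm_add, parabolicForm_smul, hx, hy, hxy]⟩

theorem QLine.eq_span {l : QLine F} {p r : QPoint F} (hne : p ≠ r) (hp : QInc p l)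
    (hr : QInc r l) : l.1 = Submodule.span F {p.vec, r.vec} := by
  symm
  apply Submodule.eq_of_le_of_finrank_eq
  · rw [Submodule.span_le, Set.insert_subset_iff, Set.singleton_subset_iff]
    exact ⟨qInc_iff.1 hp, qInc_iff.1 hr⟩
  · rw [finrank_span_pair (linearIndependent_vec hne), l.2.1]

theorem exists_line_of_polarForm_eq_zero {p r : QPoint F} (hne : p ≠ r)
    (h : polarForm p.vec r.vec = 0) : ∃ l : QLine F, QInc p l ∧ QInc r l :=
  ⟨mkLine p.vec r.vec (linearIndependent_vec hne) p.parabolicForm_vec r.parabolicForm_vec h,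
    qInc_iff.2 (Submodule.subset_span (by simp)), qInc_iff.2 (Submodule.subset_span (by simp))⟩

/-- A totally singular subspace has dimension at most two. -/
theorem finrank_le_two_of_totally_singular (U : Submodule F (Fin 5 → F))
    (hU : ∀ x ∈ U, parabolicForm F x = 0) : Module.finrank F U ≤ 2 := by
  by_contra! hlt
  -- Two linear conditions cannot kill a space of dimension at least three. The pairs (1, 3) and (2,
  -- 4) are used because the form then reduces to X₀², which yields vectors of ⟨e₂, e₄⟩ and ⟨e₁,
  -- e₃⟩.
  have hker : ∀ i j : Fin 5, ∃ x ∈ U, x ≠ 0 ∧ x i = 0 ∧ x j = 0 := by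
    intro i j
    let f : (Fin 5 → F) →ₗ[F] F × F := (LinearMap.proj i).prod (LinearMap.proj j)
    have hf : LinearMap.ker (f.comp U.subtype) ≠ ⊥ :=
      LinearMap.ker_ne_bot_of_finrank_lt (by simpa using hlt)
    obtain ⟨x, hx, hx0⟩ := (Submodule.ne_bot_iff _).1 hf
    have hx' : x.1 i = 0 ∧ x.1 j = 0 := by simpa [f] using hx
    exact ⟨x.1, x.2, by simpa using hx0, hx'.1, hx'.2⟩
  have hB : ∀ x ∈ U, ∀ y ∈ U, polarForm x y = 0 := fun x hx y hy => by
    have h := hU _ (U.add_mem hx hy)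
    rwa [parabolicForm_add, hU x hx, hU y hy, zero_add, zero_add] at h
  obtain ⟨x, hx, hx0, hx1, hx3⟩ := hker 1 3
  obtain ⟨y, hy, hy0, hy2, hy4⟩ := hker 2 4
  have hx00 : x 0 = 0 := by
    have h := hU x hx; rw [parabolicForm_apply] at h; simpa [hx1, hx3] using h
  have hy00 : y 0 = 0 := by
    have h := hU y hy; rw [parabolicForm_apply] at h; simpa [hy2, hy4] using h
  have hxne : x 2 ≠ 0 ∨ x 4 ≠ 0 := by
    by_contra! h
    exact hx0 (funext fun i => by fin_cases i <;> simp_all)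
  have hyne : y 1 ≠ 0 ∨ y 3 ≠ 0 := by
    by_contra! h
    exact hy0 (funext fun i => by fin_cases i <;> simp_all)
  have hxy := hB x hx y hy
  simp only [polarForm_apply, hx00, hx1, hx3, hy00, hy2, hy4] at hxy
  have hsub : U ≤ Submodule.span F {x, y} := by
    intro z hz
    have hzx := hB z hz x hx
    have hzy := hB z hz y hy
    have hzq := hU z hz
    simp only [polarForm_apply, parabolicForm_apply, hx00, hx1, hx3, hy00, hy2, hy4] at hzx hzy hzq
    -- Both (z₂, z₄) and (x₂, x₄) annihilate the nonzero pair (y₁, y₃), so they are proportional;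
    -- `h2` is the same with the roles of `x` and `y` exchanged.
    have h1 : ∃ a, z 2 = a * x 2 ∧ z 4 = a * x 4 := by
      rcases hxne with h | h
      · refine ⟨z 2 / x 2, by field_simp, ?_⟩
        rcases hyne with k | k
        all_goals
          field_simp
          apply mul_right_cancel₀ k
          grind
      · refine ⟨z 4 / x 4, ?_, by field_simp⟩
        rcases hyne with k | k
        all_goals
          field_simp
          apply mul_right_cancel₀ k
          grind
    have h2 : ∃ b, z 1 = b * y 1 ∧ z 3 = b * y 3 := by
      rcases hyne with h | h
      · refine ⟨z 1 / y 1, by field_simp, ?_⟩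
        rcases hxne with k | k
        all_goals
          field_simp
          apply mul_right_cancel₀ k
          grind
      · refine ⟨z 3 / y 3, ?_, by field_simp⟩
        rcases hxne with k | k
        all_goals
          field_simp
          apply mul_right_cancel₀ k
          grind
    obtain ⟨a, ha2, ha4⟩ := h1
    obtain ⟨b, hb1, hb3⟩ := h2
    have hz0 : z 0 = 0 := by
      have : z 0 ^ 2 = 0 := by grind
      simpa using this
    refine Submodule.mem_span_pair.2 ⟨a, b, funext fun i => ?_⟩
    fin_cases i <;> simp_all
  have h1 := Submodule.finrank_mono hsub
  have h2 : Module.finrank F (Submodule.span F ({x, y} : Set (Fin 5 → F))) ≤ 2 := by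
    classical
    have := (finrank_span_finset_le_card (R := F) {x, y}).trans Finset.card_le_two
    rwa [Finset.coe_pair] at this
  omega

/-- A singular vector orthogonal to a line of the quadric belongs to the line. -/
theorem mem_line_of_polarForm_eq_zero {l : QLine F} {x : Fin 5 → F}
    (hx : parabolicForm F x = 0) (h : ∀ y ∈ l.1, polarForm x y = 0) : x ∈ l.1 := by
  have hU : ∀ z ∈ l.1 ⊔ Submodule.span F {x}, parabolicForm F z = 0 := by
    intro z hz
    obtain ⟨y, hy, w, hw, rfl⟩ := Submodule.mem_sup.1 hz
    obtain ⟨c, rfl⟩ := Submodule.mem_span_singleton.1 hw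
    rw [parabolicForm_add, parabolicForm_smul, hx, l.2.2 y hy, polarForm_comm, map_smul,
      LinearMap.smul_apply, h y hy]
    simp
  have heq := Submodule.eq_of_le_of_finrank_le (le_sup_left : l.1 ≤ l.1 ⊔ Submodule.span F {x})
    (by rw [l.2.1]; exact finrank_le_two_of_totally_singular _ hU)
  rw [heq]
  exact Submodule.mem_sup_right (Submodule.mem_span_singleton_self x)

theorem qLine_unique (p r : QPoint F) (l m : QLine F) (hne : p ≠ r) (hpl : QInc p l)
    (hrl : QInc r l) (hpm : QInc p m) (hrm : QInc r m) : l = m :=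
  Subtype.ext ((QLine.eq_span hne hpl hrl).trans (QLine.eq_span hne hpm hrm).symm)

/-- Existence: a linear functional on a two-dimensional space has a nonzero kernel. Uniqueness: two
distinct projections would make `p` orthogonal to all of `l`, hence a point of `l`. -/
theorem qLine_projection (p : QPoint F) (l : QLine F) (hp : ¬ QInc p l) :
    ∃! m : QLine F, QInc p m ∧ ∃ r : QPoint F, QInc r m ∧ QInc r l := by
  have hex : ∃ r : QPoint F, QInc r l ∧ polarForm p.vec r.vec = 0 := by
    have hf : LinearMap.ker ((polarForm p.vec).comp l.1.subtype) ≠ ⊥ :=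
      LinearMap.ker_ne_bot_of_finrank_lt (by rw [l.2.1]; simp)
    obtain ⟨x, hx, hx0⟩ := (Submodule.ne_bot_iff _).1 hf
    have hx0' : x.1 ≠ 0 := by simpa using hx0
    refine ⟨mkPoint x.1 hx0' (l.2.2 _ x.2), (qInc_mkPoint _ _).2 x.2, ?_⟩
    obtain ⟨c, -, h⟩ := vec_mkPoint x.1 hx0' (l.2.2 _ x.2)
    have hx' : polarForm p.vec x.1 = 0 := by simpa using hx
    rw [h, map_smul, hx', smul_zero]
  have hne : ∀ r : QPoint F, QInc r l → p ≠ r := fun r hr h => hp (h ▸ hr)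
  obtain ⟨r, hr, hpr⟩ := hex
  obtain ⟨m, hpm, hrm⟩ := exists_line_of_polarForm_eq_zero (hne r hr) hpr
  refine ⟨m, ⟨hpm, r, hrm, hr⟩, ?_⟩
  rintro m' ⟨hpm', r', hrm', hr'⟩
  by_cases h : r = r'
  · subst h
    exact qLine_unique p r m' m (hne r hr) hpm' hrm' hpm hrm
  · exfalso
    refine hp (qInc_iff.2 (mem_line_of_polarForm_eq_zero p.parabolicForm_vec fun y hy => ?_))
    rw [QLine.eq_span h hr hr'] at hy
    obtain ⟨a, b, rfl⟩ := Submodule.mem_span_pair.1 hy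
    rw [map_add, map_smul, map_smul, hpr, polarForm_eq_zero_of_qInc hpm' hrm']
    simp

/-! ### Counting -/

instance [Finite F] : Finite (QPoint F) :=
  inferInstanceAs (Finite (Subtype (α := Projectivization F (Fin 5 → F)) _))

instance [Finite F] : Finite (QLine F) :=
  Finite.of_injective (fun l : QLine F => (l.1 : Set (Fin 5 → F)))
    fun _ _ h => Subtype.ext (SetLike.coe_injective h)

theorem ncard_points [Finite F] (l : QLine F) :
    {p : QPoint F | QInc p l}.ncard = Nat.card F + 1 := by
  rw [← Projectivization.card_of_finrank_two F l.1 l.2.1, ← Nat.card_coe_set_eq, eq_comm]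
  have hmem : ∀ z : Projectivization F l.1,
      (Projectivization.map l.1.subtype l.1.injective_subtype z).submodule ≤ l.1 := by
    intro z
    induction z using Projectivization.ind with
    | h x hx =>
      rw [Projectivization.map_mk, Projectivization.submodule_mk,
        Submodule.span_singleton_le_iff_mem]
      exact x.2
  refine Nat.card_congr (Equiv.ofBijective (fun z =>
    (⟨⟨_, fun x hx => l.2.2 x (hmem z hx)⟩, hmem z⟩ : {p : QPoint F | QInc p l})) ⟨?_, ?_⟩)
  · intro z z' h
    exact Projectivization.map_injective _ l.1.injective_subtype
      (Subtype.ext_iff.1 (Subtype.ext_iff.1 h))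
  · rintro ⟨p, hp⟩
    refine ⟨Projectivization.mk F ⟨p.vec, qInc_iff.1 hp⟩ ?_, ?_⟩
    · simpa using p.vec_ne_zero
    · apply Subtype.ext
      apply Subtype.ext
      exact p.1.mk_rep

/-- Send a line through `p` to the line through `r` that meets it. Projecting back from `p` recovers
the original line, so this is injective. -/
theorem ncard_lines_le_of_polarForm_ne_zero [Finite F] {p r : QPoint F}
    (h : polarForm p.vec r.vec ≠ 0) :
    {l : QLine F | QInc p l}.ncard ≤ {l : QLine F | QInc r l}.ncard := by
  have hnot : ∀ m : QLine F, QInc p m → ¬ QInc r m := fun m hp hr =>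
    h (polarForm_eq_zero_of_qInc hp hr)
  have hex : ∀ m : QLine F, ∃ m' : QLine F, QInc p m →
      QInc r m' ∧ ∃ z : QPoint F, QInc z m' ∧ QInc z m := fun m => by
    by_cases hm : QInc p m
    · exact (qLine_projection r m (hnot m hm)).exists.imp fun _ h _ => h
    -- Dummy value for lines not through `p`, which makes the choice total.
    · exact ⟨m, fun h => absurd h hm⟩
  choose f hf using hex
  refine Set.ncard_le_ncard_of_injOn f (fun m hm => (hf m hm).1) ?_
  intro m hm m' hm' heq
  have hpf : ¬ QInc p (f m) := fun hp => hnot _ hp (hf m hm).1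
  refine (qLine_projection p (f m) hpf).unique ⟨hm, ?_⟩ ⟨hm', ?_⟩
  · exact (hf m hm).2.imp fun _ hz => hz.symm
  · rw [heq]
    exact (hf m' hm').2.imp fun _ hz => hz.symm

theorem ncard_lines_eq_of_polarForm_ne_zero [Finite F] {p r : QPoint F}
    (h : polarForm p.vec r.vec ≠ 0) :
    {l : QLine F | QInc p l}.ncard = {l : QLine F | QInc r l}.ncard :=
  (ncard_lines_le_of_polarForm_ne_zero h).antisymm
    (ncard_lines_le_of_polarForm_ne_zero (by rwa [polarForm_comm]))

theorem polarForm_vec_mkPoint_eq_zero_iff {x y : Fin 5 → F} (hx : x ≠ 0)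
    (hq : parabolicForm F x = 0) :
    polarForm y (mkPoint x hx hq).vec = 0 ↔ polarForm y x = 0 := by
  obtain ⟨c, hc, h⟩ := vec_mkPoint x hx hq
  rw [h, map_smul, smul_eq_zero, or_iff_right hc]

end Quadric

/-! ### Parameters of the quadrangle, and the section X₀ = 0 -/

section Quadric

variable {F : Type u} [Field F]

/-- Modulo e₁, the space orthogonal to e₁ carries the form X₀² + X₃X₄. The lines through ⟨e₁⟩
therefore correspond to the points of a conic, parametrized by F together with a point at infinity.
-/
theorem ncard_lines_through_mkPoint_one [Finite F] (hx : (![0, 1, 0, 0, 0] : Fin 5 → F) ≠ 0)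
    (hq : parabolicForm F ![0, 1, 0, 0, 0] = 0) :
    {l : QLine F | QInc (mkPoint _ hx hq) l}.ncard = Nat.card F + 1 := by
  let g : Option F → Fin 5 → F := fun o => o.elim ![0, 0, 0, 0, 1] fun t => ![t, 0, 0, 1, -t ^ 2]
  have hg : ∀ o, LinearIndependent F ![![0, 1, 0, 0, 0], g o] := by
    intro o
    rw [LinearIndependent.pair_iff' hx]
    intro a h
    rcases o with _ | t
    · simpa [g] using congrFun h 4
    · simpa [g] using congrFun h 3
  let f : Option F → QLine F := fun o => mkLine _ (g o) (hg o) hq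
    (by rcases o with _ | t <;> simp [g, parabolicForm_apply])
    (by rcases o with _ | t <;> simp [g, polarForm_apply])
  have hmem : ∀ o, g o ∈ (f o).1 := fun o => Submodule.subset_span (by simp)
  have hf : Function.Injective f := by
    intro o o' h
    have h1 := hmem o
    rw [h] at h1
    obtain ⟨a, b, hab⟩ := Submodule.mem_span_pair.1 h1
    have h0 := congrFun hab 0
    have h3 := congrFun hab 3
    have h4 := congrFun hab 4
    rcases o with _ | t <;> rcases o' with _ | t' <;> simp [g] at h0 h3 h4 ⊢
    · simp [h3] at h4
    · simpa [h3] using h0.symm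
  have hrange : {l : QLine F | QInc (mkPoint _ hx hq) l} = Set.range f := by
    ext l
    rw [Set.mem_ofPred_eq, qInc_mkPoint, Set.mem_range]
    constructor
    · intro hl
      have hcard : 1 < {p : QPoint F | QInc p l}.ncard := by
        rw [ncard_points]
        exact Nat.lt_add_of_pos_left Nat.card_pos
      obtain ⟨r, hr, hne⟩ := Set.exists_ne_of_one_lt_ncard hcard (mkPoint _ hx hq)
      have hB := polarForm_eq_zero_of_qInc hr ((qInc_mkPoint hx hq).2 hl)
      rw [polarForm_vec_mkPoint_eq_zero_iff, polarForm_apply] at hB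
      have h2 : r.vec 2 = 0 := by simpa using hB
      have hQ := r.parabolicForm_vec
      rw [parabolicForm_apply, h2, mul_zero, add_zero] at hQ
      -- Removing the e₁-component of a second point of `l` and normalizing coordinate 3, or
      -- coordinate 4 if the former vanishes, gives a conic representative.
      have key : ∃ o, g o ∈ l.1 := by
        have hrl := qInc_iff.1 hr
        by_cases h3 : r.vec 3 = 0
        · have h0 : r.vec 0 = 0 := by simpa [h3] using hQ
          have h4 : r.vec 4 ≠ 0 := by
            intro h4
            obtain ⟨c, -, hc⟩ := vec_mkPoint _ hx hq
            have hvec : r.vec = r.vec 1 • ![0, 1, 0, 0, 0] :=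
              funext fun i => by fin_cases i <;> simp [h0, h2, h3, h4]
            have h1 : r.vec 1 ≠ 0 := fun h1 => r.vec_ne_zero (by rw [hvec, h1, zero_smul])
            refine hne (QPoint.ext_of_smul (c := c / r.vec 1) ?_)
            rw [hc, hvec, smul_smul]
            simp [h1]
          refine ⟨none, ?_⟩
          have : g none = (r.vec 4)⁻¹ • (r.vec - r.vec 1 • ![0, 1, 0, 0, 0]) :=
            funext fun i => by
              change _ = _ * (r.vec i - _ * _)
              fin_cases i <;> simp [g, h0, h2, h3, h4]
          rw [this]
          exact l.1.smul_mem _ (l.1.sub_mem hrl (l.1.smul_mem _ hl))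
        · refine ⟨some (r.vec 0 / r.vec 3), ?_⟩
          have : g (some (r.vec 0 / r.vec 3)) =
              (r.vec 3)⁻¹ • (r.vec - r.vec 1 • ![0, 1, 0, 0, 0]) := by
            funext i
            change _ = _ * (r.vec i - _ * _)
            fin_cases i <;> simp [g, h2, h3]
            · field_simp
            · field_simp
              linear_combination -hQ
          rw [this]
          exact l.1.smul_mem _ (l.1.sub_mem hrl (l.1.smul_mem _ hl))
      obtain ⟨o, ho⟩ := key
      refine ⟨o, Subtype.ext (Submodule.eq_of_le_of_finrank_eq ?_ ((f o).2.1.trans l.2.1.symm))⟩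
      refine Submodule.span_le.2 ?_
      rintro z (rfl | rfl)
      exacts [hl, ho]
    · rintro ⟨o, rfl⟩
      exact Submodule.subset_span (by simp)
  rw [hrange, ← Nat.card_coe_set_eq, Nat.card_range_of_injective hf, Finite.card_option]

/-- Noncollinear points have equally many lines, so the count at ⟨e₁⟩ spreads to the four base
points ⟨e₁⟩, …, ⟨e₄⟩. The auxiliary point (0, 1, 1, -1, 1) connects ⟨e₁⟩ to ⟨e₃⟩, which are
collinear. Every singular vector is nonorthogonal to a base point, since otherwise only X₀ survives
and the form makes it vanish. -/
theorem ncard_lines [Finite F] (p : QPoint F) :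
    {l : QLine F | QInc p l}.ncard = Nat.card F + 1 := by
  have n1 : (![0, 1, 0, 0, 0] : Fin 5 → F) ≠ 0 := fun h => by simpa using congrFun h 1
  have n2 : (![0, 0, 1, 0, 0] : Fin 5 → F) ≠ 0 := fun h => by simpa using congrFun h 2
  have n3 : (![0, 0, 0, 1, 0] : Fin 5 → F) ≠ 0 := fun h => by simpa using congrFun h 3
  have n4 : (![0, 0, 0, 0, 1] : Fin 5 → F) ≠ 0 := fun h => by simpa using congrFun h 4
  have n5 : (![0, 1, 1, -1, 1] : Fin 5 → F) ≠ 0 := fun h => by simpa using congrFun h 1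
  have q1 : parabolicForm F ![0, 1, 0, 0, 0] = 0 := by simp [parabolicForm_apply]
  have q2 : parabolicForm F ![0, 0, 1, 0, 0] = 0 := by simp [parabolicForm_apply]
  have q3 : parabolicForm F ![0, 0, 0, 1, 0] = 0 := by simp [parabolicForm_apply]
  have q4 : parabolicForm F ![0, 0, 0, 0, 1] = 0 := by simp [parabolicForm_apply]
  have q5 : parabolicForm F ![0, 1, 1, -1, 1] = 0 := by simp [parabolicForm_apply]
  have step : ∀ {x y : Fin 5 → F} (hx : x ≠ 0) (hy : y ≠ 0) (hqx : parabolicForm F x = 0)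
      (hqy : parabolicForm F y = 0), polarForm y x ≠ 0 →
      {l : QLine F | QInc (mkPoint x hx hqx) l}.ncard =
        {l : QLine F | QInc (mkPoint y hy hqy) l}.ncard := by
    intro x y hx hy hqx hqy h
    apply ncard_lines_eq_of_polarForm_ne_zero
    rwa [Ne, polarForm_vec_mkPoint_eq_zero_iff, polarForm_comm, polarForm_vec_mkPoint_eq_zero_iff]
  have c1 := ncard_lines_through_mkPoint_one n1 q1
  have c2 := (step n2 n1 q2 q1 (by simp [polarForm_apply])).trans c1
  have c5 := (step n5 n1 q5 q1 (by simp [polarForm_apply])).trans c1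
  have c3 := (step n3 n5 q3 q5 (by simp [polarForm_apply])).trans c5
  have c4 := (step n4 n3 q4 q3 (by simp [polarForm_apply])).trans c3
  have last : ∀ {x : Fin 5 → F} (hx : x ≠ 0) (hqx : parabolicForm F x = 0),
      {l : QLine F | QInc (mkPoint x hx hqx) l}.ncard = Nat.card F + 1 →
      polarForm p.vec x ≠ 0 → {l : QLine F | QInc p l}.ncard = Nat.card F + 1 := by
    intro x hx hqx hcard h
    rw [← hcard]
    apply ncard_lines_eq_of_polarForm_ne_zero
    rwa [Ne, polarForm_vec_mkPoint_eq_zero_iff]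
  by_cases h1 : p.vec 1 = 0
  · by_cases h2 : p.vec 2 = 0
    · by_cases h3 : p.vec 3 = 0
      · by_cases h4 : p.vec 4 = 0
        · have h0 := p.parabolicForm_vec
          rw [parabolicForm_apply, h1, h3] at h0
          have h0' : p.vec 0 = 0 := by simpa using h0
          exact absurd (funext fun i => by fin_cases i <;> simp [*]) p.vec_ne_zero
        · exact last n3 q3 c3 (by simpa [polarForm_apply] using h4)
      · exact last n4 q4 c4 (by simpa [polarForm_apply] using h3)
    · exact last n1 q1 c1 (by simpa [polarForm_apply] using h2)
  · exact last n2 q2 c2 (by simpa [polarForm_apply] using h1)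

/-- The parabolic quadric `Q(4,q)` is a generalized quadrangle of order `q`. -/
theorem isGQ_qInc [Finite F] : IsGQ (QInc (F := F)) (Nat.card F) (Nat.card F) where
  s_pos := Nat.card_pos
  t_pos := Nat.card_pos
  line_unique := qLine_unique
  points_on_line := ncard_points
  lines_through_point := ncard_lines
  projection := qLine_projection

/-- On the chart X₁ = 1 the equation of the quadric can be solved for X₂, leaving three free
coordinates. -/
theorem card_pow_three_le_card_qPoint [Finite F] : Nat.card F ^ 3 ≤ Nat.card (QPoint F) := by
  let x : F × F × F → Fin 5 → F := fun a =>
    ![a.1, 1, -(a.1 ^ 2 + a.2.1 * a.2.2), a.2.1, a.2.2]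
  have hx : ∀ a, x a ≠ 0 := fun a h => by simpa [x] using congrFun h 1
  have hq : ∀ a, parabolicForm F (x a) = 0 := fun a => by
    simp only [parabolicForm_apply, x]
    simp
  have hinj : Function.Injective fun a => mkPoint (x a) (hx a) (hq a) := by
    intro a b h
    obtain ⟨c, hc⟩ := (mkPoint_eq_iff _ _ _ _).1 h
    have h1 : c = 1 := by simpa [x] using congrFun hc 1
    rw [h1, one_smul] at hc
    have h0 := congrFun hc 0
    have h3 := congrFun hc 3
    have h4 := congrFun hc 4
    simp only [x] at h0 h3 h4
    simp at h0 h3 h4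
    exact Prod.ext h0.symm (Prod.ext h3.symm h4.symm)
  have := Nat.card_le_card_of_injective _ hinj
  rw [Nat.card_prod, Nat.card_prod] at this
  calc Nat.card F ^ 3 = Nat.card F * (Nat.card F * Nat.card F) := by ring
    _ ≤ _ := this

/-- The hyperplane `X₀ = 0` meets the parabolic quadric in a hyperbolic quadric. -/
theorem isHyperbolicHyperplane_ker_proj_zero :
    IsHyperbolicHyperplane (LinearMap.ker (LinearMap.proj 0 : (Fin 5 → F) →ₗ[F] F)) := by
  let e : LinearMap.ker (LinearMap.proj 0 : (Fin 5 → F) →ₗ[F] F) ≃ₗ[F] (Fin 4 → F) :=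
    { toFun := fun x i => x.1 i.succ
      map_add' := fun _ _ => rfl
      map_smul' := fun _ _ => rfl
      invFun := fun y => ⟨Fin.cons 0 y, by simp⟩
      left_inv := by
        rintro ⟨x, hx⟩
        have hx0 : x 0 = 0 := by simpa using hx
        apply Subtype.ext
        funext i
        refine Fin.cases ?_ (fun j => ?_) i
        · simp [hx0]
        · simp
      right_inv := fun y => by funext i; simp }
  refine ⟨by rw [e.finrank_eq]; simp, ⟨{ e with map_app' := ?_ }⟩⟩
  rintro ⟨x, hx⟩
  have hx0 : x 0 = 0 := by simpa using hx
  change hyperbolicForm F (fun i : Fin 4 => x i.succ) = parabolicForm F x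
  rw [hyperbolicForm_apply, parabolicForm_apply, hx0]
  simp

/-- Let `x`, `y` be distinct points of the quadric that are not collinear, do not belong to the
lines `x₂ = x₄ = 0` and `x₁ = x₃ = 0` of the section `x₀ = 0`, and have the same
projections onto these lines and a third line of their regulus. Then the points collinear
with both `x` and `y` are in the section. -/
theorem zero_coord_of_common_collinear {x y : QPoint F} {a₀ b₀ a₁ b₁ a₂ b₂ : F} (hne : x ≠ y)
    (hxy : polarForm x.vec y.vec ≠ 0)
    (hx24 : x.vec 2 ≠ 0 ∨ x.vec 4 ≠ 0) (hx13 : x.vec 1 ≠ 0 ∨ x.vec 3 ≠ 0)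
    (h0 : a₀ ≠ 0 ∨ b₀ ≠ 0) (h1 : a₁ ≠ 0 ∨ b₁ ≠ 0) (h2 : a₂ ≠ 0 ∨ b₂ ≠ 0)
    (hx0 : polarForm x.vec ![0, a₀, 0, b₀, 0] = 0) (hy0 : polarForm y.vec ![0, a₀, 0, b₀, 0] = 0)
    (hx1 : polarForm x.vec ![0, 0, a₁, 0, b₁] = 0) (hy1 : polarForm y.vec ![0, 0, a₁, 0, b₁] = 0)
    (hx2 : polarForm x.vec ![0, a₂, -b₂, b₂, a₂] = 0)
    (hy2 : polarForm y.vec ![0, a₂, -b₂, b₂, a₂] = 0)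
    {s : Fin 5 → F} (hxs : polarForm x.vec s = 0) (hys : polarForm y.vec s = 0) : s 0 = 0 := by
  have hqx := x.parabolicForm_vec
  have hqy := y.parabolicForm_vec
  have hscal : ∀ c : F, y.vec ≠ c • x.vec := fun c h => hne (QPoint.ext_of_smul h)
  generalize x.vec = x at *
  generalize y.vec = y at *
  have hpar : ∀ {a b u v : F}, (a ≠ 0 ∨ b ≠ 0) → u * a + v * b = 0 →
      ∃ c, u = c * b ∧ v = -(c * a) := by
    intro a b u v hab h
    rcases hab with ha | hb
    · exact ⟨-v / a, by field_simp; linear_combination h, by field_simp⟩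
    · exact ⟨u / b, by field_simp, by field_simp; linear_combination h⟩
  simp only [polarForm_apply] at hx0 hy0 hx1 hy1 hx2 hy2
  simp at hx0 hy0 hx1 hy1 hx2 hy2
  obtain ⟨α, hx2', hx4'⟩ := hpar h0 hx0
  obtain ⟨α', hy2', hy4'⟩ := hpar h0 hy0
  obtain ⟨β, hx1', hx3'⟩ := hpar h1 hx1
  obtain ⟨β', hy1', hy3'⟩ := hpar h1 hy1
  rw [parabolicForm_apply] at hqx hqy
  rw [polarForm_apply] at hxy hxs hys
  rw [hx2', hx4', hx1', hx3'] at hqx hxs hx2 hxy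
  rw [hx2', hx4'] at hx24
  rw [hx1', hx3'] at hx13
  rw [hy2', hy4', hy1', hy3'] at hqy hys hy2 hxy
  have hα : α ≠ 0 := by rintro rfl; simp at hx24
  have hβ : β ≠ 0 := by rintro rfl; simp at hx13
  have eK : α * (a₂ * b₀ - b₂ * a₀) = β * (a₂ * a₁ + b₂ * b₁) := by linear_combination hx2
  have eK' : α' * (a₂ * b₀ - b₂ * a₀) = β' * (a₂ * a₁ + b₂ * b₁) := by linear_combination hy2
  -- If this vanishes, the three projections lie on a common transversal, and `x` and `y` are forced
  -- to be orthogonal. Otherwise the coordinates 1 to 4 of `x` and `y` are proportional.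
  by_cases hK : a₂ * b₀ - b₂ * a₀ = 0
  · exfalso
    have hL : a₂ * a₁ + b₂ * b₁ = 0 := by
      rw [hK, mul_zero, eq_comm, mul_eq_zero] at eK
      exact eK.resolve_left hβ
    have hD : a₀ * a₁ + b₀ * b₁ = 0 := by
      rcases h2 with h | h
      · apply mul_left_cancel₀ h
        linear_combination b₁ * hK + a₀ * hL
      · apply mul_left_cancel₀ h
        linear_combination -a₁ * hK + b₀ * hL
    have hx00 : x 0 = 0 := by
      have : x 0 ^ 2 = 0 := by linear_combination hqx - α * β * hD
      simpa using this
    apply hxy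
    rw [hx00]
    linear_combination (α * β' + α' * β) * hD
  · have hL : a₂ * a₁ + b₂ * b₁ ≠ 0 := by
      intro hL
      rw [hL, mul_zero, mul_eq_zero] at eK
      exact eK.elim hα hK
    obtain ⟨c, hc⟩ : ∃ c, α' = c * α := ⟨α' / α, by field_simp⟩
    have hc' : β' = c * β := by
      apply mul_right_cancel₀ hL
      linear_combination c * eK - eK' + (a₂ * b₀ - b₂ * a₀) * hc
    -- The quadric determines X₀ up to sign. The plus sign would give equal points, so the minus
    -- sign holds; as the signs then differ, the characteristic is not 2.
    have hsq : (y 0 - c * x 0) * (y 0 + c * x 0) = 0 := by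
      rw [hc, hc'] at hqy
      linear_combination hqy - c ^ 2 * hqx
    have hne0 : y 0 ≠ c * x 0 := by
      intro h
      refine hscal c (funext fun i => ?_)
      fin_cases i
      · exact h
      · simp [hy1', hx1', hc', mul_assoc]
      · simp [hy2', hx2', hc, mul_assoc]
      · simp [hy3', hx3', hc', mul_assoc]
      · simp [hy4', hx4', hc, mul_assoc]
    have hneg : y 0 = -(c * x 0) := by
      linear_combination (mul_eq_zero.1 hsq).resolve_left (sub_ne_zero.2 hne0)
    have h2cx : 2 * (c * x 0) ≠ 0 := fun h => hne0 (by linear_combination hneg - h)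
    have h20 : (2 : F) ≠ 0 := left_ne_zero_of_mul h2cx
    rw [hc, hc', hneg] at hys
    have : 2 * (2 * (c * x 0)) * s 0 = 0 := by linear_combination c * hxs - hys
    exact (mul_eq_zero.1 this).resolve_left (mul_ne_zero h20 h2cx)

end Quadric

/-! ### The code in a generalized quadrangle with a distinguished subspace -/

section Configuration

variable {P : Type v} {L : Type w} {inc : P → L → Prop} {s t : ℕ}

/-- The configuration of five lines that carries the code, in a generalized quadrangle with a
distinguished subspace `S`: three pairwise skew lines of `S`, and lines through two points of the
third that meet `S` only there. One point of each line is marked; those on the first two lines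
are on a line `n` through `p₁`. -/
structure IsCodeConfiguration (inc : P → L → Prop) (S : Set P) (n l₀ l₁ l₂ m₁ m₂ : L)
    (p₁ p₂ a₀ a₁ a₂ b₁ b₂ : P) : Prop where
  subspace : ∀ p r l, p ≠ r → inc p l → inc r l → p ∈ S → r ∈ S → ∀ z, inc z l → z ∈ S
  l₀_subset : ∀ z, inc z l₀ → z ∈ S
  l₁_subset : ∀ z, inc z l₁ → z ∈ S
  l₂_subset : ∀ z, inc z l₂ → z ∈ S
  l₀_l₁ : ∀ z, inc z l₀ → ¬ inc z l₁
  l₀_l₂ : ∀ z, inc z l₀ → ¬ inc z l₂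
  l₁_l₂ : ∀ z, inc z l₁ → ¬ inc z l₂
  p₁_ne_p₂ : p₁ ≠ p₂
  p₁_l₂ : inc p₁ l₂
  p₂_l₂ : inc p₂ l₂
  p₁_m₁ : inc p₁ m₁
  p₂_m₂ : inc p₂ m₂
  m₁_inter : ∀ z, inc z m₁ → z ∈ S → z = p₁
  m₂_inter : ∀ z, inc z m₂ → z ∈ S → z = p₂
  a₀_l₀ : inc a₀ l₀
  a₁_l₁ : inc a₁ l₁
  a₂_l₂ : inc a₂ l₂
  b₁_m₁ : inc b₁ m₁
  b₂_m₂ : inc b₂ m₂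
  a₂_ne_p₁ : a₂ ≠ p₁
  a₂_ne_p₂ : a₂ ≠ p₂
  b₁_ne_p₁ : b₁ ≠ p₁
  b₂_ne_p₂ : b₂ ≠ p₂
  a₀_n : inc a₀ n
  a₁_n : inc a₁ n
  p₁_n : inc p₁ n

/-- The union of five lines with five points removed. -/
def codeOf (inc : P → L → Prop) (l₀ l₁ l₂ m₁ m₂ : L) (a₀ a₁ a₂ b₁ b₂ : P) : Set P :=
  ({p | inc p l₀} ∪ {p | inc p l₁} ∪ {p | inc p l₂} ∪ {p | inc p m₁} ∪ {p | inc p m₂}) \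
    {a₀, a₁, a₂, b₁, b₂}

namespace IsCodeConfiguration

variable {S : Set P} {n l₀ l₁ l₂ m₁ m₂ : L} {p₁ p₂ a₀ a₁ a₂ b₁ b₂ : P} {z : P}

section

variable (h : IsCodeConfiguration inc S n l₀ l₁ l₂ m₁ m₂ p₁ p₂ a₀ a₁ a₂ b₁ b₂)
include h

theorem l₀_m₁ (hz : inc z l₀) : ¬ inc z m₁ := fun hm =>
  h.l₀_l₂ z hz (h.m₁_inter z hm (h.l₀_subset z hz) ▸ h.p₁_l₂)

theorem l₁_m₁ (hz : inc z l₁) : ¬ inc z m₁ := fun hm =>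
  h.l₁_l₂ z hz (h.m₁_inter z hm (h.l₁_subset z hz) ▸ h.p₁_l₂)

theorem l₀_m₂ (hz : inc z l₀) : ¬ inc z m₂ := fun hm =>
  h.l₀_l₂ z hz (h.m₂_inter z hm (h.l₀_subset z hz) ▸ h.p₂_l₂)

theorem l₁_m₂ (hz : inc z l₁) : ¬ inc z m₂ := fun hm =>
  h.l₁_l₂ z hz (h.m₂_inter z hm (h.l₁_subset z hz) ▸ h.p₂_l₂)

/-- A common point off `l₂` would form a triangle with `p₁` and `p₂`. -/
theorem m₁_m₂ (hG : IsGQ inc s t) (hz : inc z m₁) : ¬ inc z m₂ := by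
  intro hz'
  by_cases hl : inc z l₂
  · have hS := h.l₂_subset z hl
    exact h.p₁_ne_p₂ ((h.m₁_inter z hz hS).symm.trans (h.m₂_inter z hz' hS))
  · exact h.p₁_ne_p₂ (hG.eq_of_collinear hl h.p₁_l₂ h.p₂_l₂ ⟨m₁, hz, h.p₁_m₁⟩
      ⟨m₂, hz', h.p₂_m₂⟩)

theorem mem_code_l₀ {r : P} (hr : inc r l₀) (hra : r ≠ a₀) :
    r ∈ codeOf inc l₀ l₁ l₂ m₁ m₂ a₀ a₁ a₂ b₁ b₂ := by
  refine ⟨Or.inl (Or.inl (Or.inl (Or.inl hr))), ?_⟩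
  rintro (rfl | rfl | rfl | rfl | rfl)
  exacts [hra rfl, h.l₀_l₁ _ hr h.a₁_l₁, h.l₀_l₂ _ hr h.a₂_l₂, h.l₀_m₁ hr h.b₁_m₁,
    h.l₀_m₂ hr h.b₂_m₂]

theorem mem_code_l₁ {r : P} (hr : inc r l₁) (hra : r ≠ a₁) :
    r ∈ codeOf inc l₀ l₁ l₂ m₁ m₂ a₀ a₁ a₂ b₁ b₂ := by
  refine ⟨Or.inl (Or.inl (Or.inl (Or.inr hr))), ?_⟩
  rintro (rfl | rfl | rfl | rfl | rfl)
  exacts [h.l₀_l₁ _ h.a₀_l₀ hr, hra rfl, h.l₁_l₂ _ hr h.a₂_l₂, h.l₁_m₁ hr h.b₁_m₁,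
    h.l₁_m₂ hr h.b₂_m₂]

theorem mem_code_l₂ {r : P} (hr : inc r l₂) (hra : r ≠ a₂) :
    r ∈ codeOf inc l₀ l₁ l₂ m₁ m₂ a₀ a₁ a₂ b₁ b₂ := by
  refine ⟨Or.inl (Or.inl (Or.inr hr)), ?_⟩
  rintro (rfl | rfl | rfl | rfl | rfl)
  exacts [h.l₀_l₂ _ h.a₀_l₀ hr, h.l₁_l₂ _ h.a₁_l₁ hr, hra rfl,
    h.b₁_ne_p₁ (h.m₁_inter _ h.b₁_m₁ (h.l₂_subset _ hr)),
    h.b₂_ne_p₂ (h.m₂_inter _ h.b₂_m₂ (h.l₂_subset _ hr))]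

theorem mem_code_m₁ (hG : IsGQ inc s t) {r : P} (hr : inc r m₁) (hra : r ≠ b₁) :
    r ∈ codeOf inc l₀ l₁ l₂ m₁ m₂ a₀ a₁ a₂ b₁ b₂ := by
  refine ⟨Or.inl (Or.inr hr), ?_⟩
  rintro (rfl | rfl | rfl | rfl | rfl)
  exacts [h.l₀_m₁ h.a₀_l₀ hr, h.l₁_m₁ h.a₁_l₁ hr,
    h.a₂_ne_p₁ (h.m₁_inter _ hr (h.l₂_subset _ h.a₂_l₂)), hra rfl, h.m₁_m₂ hG hr h.b₂_m₂]

theorem mem_code_m₂ (hG : IsGQ inc s t) {r : P} (hr : inc r m₂) (hra : r ≠ b₂) :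
    r ∈ codeOf inc l₀ l₁ l₂ m₁ m₂ a₀ a₁ a₂ b₁ b₂ := by
  refine ⟨Or.inr hr, ?_⟩
  rintro (rfl | rfl | rfl | rfl | rfl)
  exacts [h.l₀_m₂ h.a₀_l₀ hr, h.l₁_m₂ h.a₁_l₁ hr,
    h.a₂_ne_p₂ (h.m₂_inter _ hr (h.l₂_subset _ h.a₂_l₂)), h.m₁_m₂ hG h.b₁_m₁ hr, hra rfl]

/-- The doubly covered points `p₁` and `p₂` are assigned to `l₂`; the five pieces become disjoint
and can be counted as 3s + 2(s - 1). -/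
theorem codeOf_eq (hG : IsGQ inc s t) : codeOf inc l₀ l₁ l₂ m₁ m₂ a₀ a₁ a₂ b₁ b₂ =
    {p | inc p l₀} \ {a₀} ∪ {p | inc p l₁} \ {a₁} ∪ {p | inc p l₂} \ {a₂} ∪
      {p | inc p m₁} \ {p₁, b₁} ∪ {p | inc p m₂} \ {p₂, b₂} := by
  ext r
  constructor
  · rintro ⟨hr, hn⟩
    simp only [Set.mem_insert_iff, Set.mem_singleton_iff, not_or] at hn
    obtain ⟨n0, n1, n2, n3, n4⟩ := hn
    rcases hr with (((hr | hr) | hr) | hr) | hr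
    · exact Or.inl (Or.inl (Or.inl (Or.inl ⟨hr, n0⟩)))
    · exact Or.inl (Or.inl (Or.inl (Or.inr ⟨hr, n1⟩)))
    · exact Or.inl (Or.inl (Or.inr ⟨hr, n2⟩))
    · by_cases hp : r = p₁
      · exact Or.inl (Or.inl (Or.inr ⟨hp ▸ h.p₁_l₂, n2⟩))
      · exact Or.inl (Or.inr ⟨hr, fun hc => hc.elim hp n3⟩)
    · by_cases hp : r = p₂
      · exact Or.inl (Or.inl (Or.inr ⟨hp ▸ h.p₂_l₂, n2⟩))
      · exact Or.inr ⟨hr, fun hc => hc.elim hp n4⟩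
  · rintro ((((hr | hr) | hr) | hr) | hr)
    · exact h.mem_code_l₀ hr.1 hr.2
    · exact h.mem_code_l₁ hr.1 hr.2
    · exact h.mem_code_l₂ hr.1 hr.2
    · exact h.mem_code_m₁ hG hr.1 fun hc => hr.2 (Or.inr hc)
    · exact h.mem_code_m₂ hG hr.1 fun hc => hr.2 (Or.inr hc)

theorem ncard_codeOf [Finite P] (hG : IsGQ inc s t) :
    (codeOf inc l₀ l₁ l₂ m₁ m₂ a₀ a₁ a₂ b₁ b₂).ncard = 5 * s - 2 := by
  have one : ∀ {l : L} {a : P}, inc a l → ({p | inc p l} \ {a}).ncard = s := fun {l a} ha => by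
    rw [Set.ncard_sdiff_singleton_of_mem (s := {p | inc p l}) ha, hG.points_on_line]; rfl
  have two : ∀ {l : L} {a b : P}, a ≠ b → inc a l → inc b l →
      ({p | inc p l} \ {a, b}).ncard = s - 1 := fun {l a b} hne ha hb => by
    rw [Set.ncard_sdiff (t := {p | inc p l}) (Set.insert_subset ha (Set.singleton_subset_iff.2 hb)),
      hG.points_on_line, Set.ncard_pair hne]
    omega
  have hs := hG.s_pos
  rw [h.codeOf_eq hG, Set.ncard_union_eq, Set.ncard_union_eq, Set.ncard_union_eq,
    Set.ncard_union_eq, one h.a₀_l₀, one h.a₁_l₁, one h.a₂_l₂,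
    two h.b₁_ne_p₁.symm h.p₁_m₁ h.b₁_m₁, two h.b₂_ne_p₂.symm h.p₂_m₂ h.b₂_m₂]
  · omega
  · rw [Set.disjoint_left]
    exact fun r hr hr' => h.l₀_l₁ r hr.1 hr'.1
  · rw [Set.disjoint_left]
    rintro r (hr | hr) hr'
    exacts [h.l₀_l₂ r hr.1 hr'.1, h.l₁_l₂ r hr.1 hr'.1]
  · rw [Set.disjoint_left]
    rintro r ((hr | hr) | hr) hr'
    exacts [h.l₀_m₁ hr.1 hr'.1, h.l₁_m₁ hr.1 hr'.1,
      hr'.2 (Or.inl (h.m₁_inter r hr'.1 (h.l₂_subset r hr.1)))]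
  · rw [Set.disjoint_left]
    rintro r (((hr | hr) | hr) | hr) hr'
    exacts [h.l₀_m₂ hr.1 hr'.1, h.l₁_m₂ hr.1 hr'.1,
      hr'.2 (Or.inl (h.m₂_inter r hr'.1 (h.l₂_subset r hr.1))), h.m₁_m₂ hG hr.1 hr'.1]

theorem dominating (hG : IsGQ inc s t) (x : P) :
    (closedNbhd (adjacencyGraph inc) x ∩
      codeOf inc l₀ l₁ l₂ m₁ m₂ a₀ a₁ a₂ b₁ b₂).Nonempty := by
  by_contra hempty
  have key : ∀ {l : L} {a : P},
      (∀ r, inc r l → r ≠ a → r ∈ codeOf inc l₀ l₁ l₂ m₁ m₂ a₀ a₁ a₂ b₁ b₂) →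
      ∀ r, inc r l → (∃ m, inc x m ∧ inc r m) → r = a := fun hC r hr hxr => by
    by_contra hra
    exact hempty ⟨r, hG.mem_closedNbhd_iff.2 hxr, hC r hr hra⟩
  have key₀ := key fun r => h.mem_code_l₀ (r := r)
  have key₁ := key fun r => h.mem_code_l₁ (r := r)
  have key₂ := key fun r => h.mem_code_l₂ (r := r)
  obtain ⟨r₀, hr₀, hx₀⟩ := hG.exists_collinear x l₀
  obtain ⟨r₁, hr₁, hx₁⟩ := hG.exists_collinear x l₁
  obtain rfl := key₀ r₀ hr₀ hx₀
  obtain rfl := key₁ r₁ hr₁ hx₁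
  -- The projections onto `l₀` and `l₁` are the two removed points, which are distinct points of
  -- `n`.
  have hxn : inc x n := by
    by_contra hxn
    exact h.l₀_l₁ r₀ hr₀ (hG.eq_of_collinear hxn h.a₀_n h.a₁_n hx₀ hx₁ ▸ hr₁)
  exact h.a₂_ne_p₁ (key₂ p₁ h.p₁_l₂ ⟨n, hxn, h.p₁_n⟩).symm

/-- The hypothesis `hS` isolates the one property for which the coordinates of the quadric are
needed; the rest follows from the quadrangle axioms and the configuration. -/
theorem separating (hG : IsGQ inc s t) (hs : 2 ≤ s)
    (hS : ∀ x y, x ≠ y → (¬ ∃ m, inc x m ∧ inc y m) → ¬ inc x l₀ → ¬ inc x l₁ →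
      (∃ r, inc r l₀ ∧ (∃ m, inc x m ∧ inc r m) ∧ ∃ m, inc y m ∧ inc r m) →
      (∃ r, inc r l₁ ∧ (∃ m, inc x m ∧ inc r m) ∧ ∃ m, inc y m ∧ inc r m) →
      (∃ r, inc r l₂ ∧ (∃ m, inc x m ∧ inc r m) ∧ ∃ m, inc y m ∧ inc r m) →
      ∀ r, (∃ m, inc x m ∧ inc r m) → (∃ m, inc y m ∧ inc r m) → r ∈ S)
    {x y : P} (hne : x ≠ y) :
    closedNbhd (adjacencyGraph inc) x ∩ codeOf inc l₀ l₁ l₂ m₁ m₂ a₀ a₁ a₂ b₁ b₂ ≠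
      closedNbhd (adjacencyGraph inc) y ∩ codeOf inc l₀ l₁ l₂ m₁ m₂ a₀ a₁ a₂ b₁ b₂ := by
  intro heq
  have C₀ := fun r => h.mem_code_l₀ (r := r)
  have C₁ := fun r => h.mem_code_l₁ (r := r)
  have C₂ := fun r => h.mem_code_l₂ (r := r)
  have D₁ := fun r => h.mem_code_m₁ hG (r := r)
  have D₂ := fun r => h.mem_code_m₂ hG (r := r)
  -- If `x` were on `l`, so would be `y`, and a common projection onto the disjoint line `l'` would
  -- be collinear with two points of `l`.
  have skew : ∀ {l l' : L} {a a' : P},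
      (∀ r, inc r l → r ≠ a → r ∈ codeOf inc l₀ l₁ l₂ m₁ m₂ a₀ a₁ a₂ b₁ b₂) →
      (∀ r, inc r l' → r ≠ a' → r ∈ codeOf inc l₀ l₁ l₂ m₁ m₂ a₀ a₁ a₂ b₁ b₂) →
      (∀ z, inc z l' → ¬ inc z l) → ¬ inc x l := by
    intro l l' a a' hC hC' hdisj hx
    have hy := hG.mem_line_of_trace_eq hs hC heq hx
    obtain ⟨r, hr, ⟨m, hxm, hrm⟩, ⟨m', hym', hrm'⟩⟩ :=
      hG.exists_common_collinear_of_trace_eq hC' heq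
    exact hne (hG.eq_of_collinear (hdisj r hr) hx hy ⟨m, hrm, hxm⟩ ⟨m', hrm', hym'⟩)
  have hx₀ : ¬ inc x l₀ := skew C₀ C₁ fun z hz hz' => h.l₀_l₁ z hz' hz
  have hx₁ : ¬ inc x l₁ := skew C₁ C₀ h.l₀_l₁
  have hx₂ : ¬ inc x l₂ := skew C₂ C₀ h.l₀_l₂
  obtain ⟨r₀, hr₀, hxr₀, hyr₀⟩ := hG.exists_common_collinear_of_trace_eq C₀ heq
  obtain ⟨r₁, hr₁, hxr₁, hyr₁⟩ := hG.exists_common_collinear_of_trace_eq C₁ heq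
  obtain ⟨r₂, hr₂, hxr₂, hyr₂⟩ := hG.exists_common_collinear_of_trace_eq C₂ heq
  obtain ⟨u₁, hu₁, hxu₁, hyu₁⟩ := hG.exists_common_collinear_of_trace_eq D₁ heq
  obtain ⟨u₂, hu₂, hxu₂, hyu₂⟩ := hG.exists_common_collinear_of_trace_eq D₂ heq
  have hsec : u₁ ∈ S ∧ u₂ ∈ S := by
    by_cases hxy : ∃ m, inc x m ∧ inc y m
    · obtain ⟨l, hxl, hyl⟩ := hxy
      -- There are no triangles, so a point collinear with both `x` and `y` is on their line.
      have hl : ∀ r, (∃ m, inc x m ∧ inc r m) → (∃ m, inc y m ∧ inc r m) → inc r l := by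
        rintro r ⟨m, hxm, hrm⟩ ⟨m', hym', hrm'⟩
        by_contra hr
        exact hne (hG.eq_of_collinear hr hxl hyl ⟨m, hrm, hxm⟩ ⟨m', hrm', hym'⟩)
      have hsub := h.subspace r₀ r₁ l (fun hr => h.l₀_l₁ r₀ hr₀ (hr ▸ hr₁)) (hl r₀ hxr₀ hyr₀)
        (hl r₁ hxr₁ hyr₁) (h.l₀_subset r₀ hr₀) (h.l₁_subset r₁ hr₁)
      exact ⟨hsub u₁ (hl u₁ hxu₁ hyu₁), hsub u₂ (hl u₂ hxu₂ hyu₂)⟩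
    · have hsub := hS x y hne hxy hx₀ hx₁ ⟨r₀, hr₀, hxr₀, hyr₀⟩ ⟨r₁, hr₁, hxr₁, hyr₁⟩
        ⟨r₂, hr₂, hxr₂, hyr₂⟩
      exact ⟨hsub u₁ hxu₁ hyu₁, hsub u₂ hxu₂ hyu₂⟩
  obtain rfl := h.m₁_inter u₁ hu₁ hsec.1
  obtain rfl := h.m₂_inter u₂ hu₂ hsec.2
  exact h.p₁_ne_p₂ (hG.eq_of_collinear hx₂ h.p₁_l₂ h.p₂_l₂ hxu₁ hxu₂)

end

end IsCodeConfiguration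

end Configuration
-- Coordinates for the configuration in the quadric
section Code

variable {F : Type u} [Field F]

theorem eq_mkPoint_of_vec_eq_smul {z : QPoint F} {x : Fin 5 → F} (hx : x ≠ 0)
    (hq : parabolicForm F x = 0) {a : F} (h : z.vec = a • x) : z = mkPoint x hx hq := by
  obtain ⟨c, hc, hc'⟩ := vec_mkPoint x hx hq
  refine (QPoint.ext_of_smul (c := a / c) ?_).symm
  rw [h, hc', smul_smul, div_mul_cancel₀ _ hc]

theorem qInc_mkLine {x y : Fin 5 → F} {h : LinearIndependent F ![x, y]}
    {hx : parabolicForm F x = 0} {hy : parabolicForm F y = 0} {hxy : polarForm x y = 0}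
    {z : QPoint F} : QInc z (mkLine x y h hx hy hxy) ↔ ∃ a b : F, a • x + b • y = z.vec := by
  rw [qInc_iff]
  exact Submodule.mem_span_pair

/-- The code configuration in `Q(4,F)`; the distinguished subspace is the section `X₀ = 0`. -/
theorem exists_isCodeConfiguration : ∃ (n l₀ l₁ l₂ m₁ m₂ : QLine F)
    (p₁ p₂ a₀ a₁ a₂ b₁ b₂ : QPoint F),
    IsCodeConfiguration QInc {p : QPoint F | p.vec 0 = 0} n l₀ l₁ l₂ m₁ m₂ p₁ p₂ a₀ a₁ a₂ b₁ b₂ ∧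
    (∀ z, QInc z l₀ ↔ ∃ a b, z.vec = ![0, a, 0, b, 0]) ∧
    (∀ z, QInc z l₁ ↔ ∃ a b, z.vec = ![0, 0, a, 0, b]) ∧
    (∀ z, QInc z l₂ ↔ ∃ a b, z.vec = ![0, a, -b, b, a]) := by
  have n1 : (![0, 1, 0, 0, 0] : Fin 5 → F) ≠ 0 := fun h => by simpa using congrFun h 1
  have n2 : (![0, 0, 1, 0, 0] : Fin 5 → F) ≠ 0 := fun h => by simpa using congrFun h 2
  have n4 : (![0, 0, 0, 0, 1] : Fin 5 → F) ≠ 0 := fun h => by simpa using congrFun h 4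
  have np₁ : (![0, 1, 0, 0, 1] : Fin 5 → F) ≠ 0 := fun h => by simpa using congrFun h 1
  have np₂ : (![0, 0, -1, 1, 0] : Fin 5 → F) ≠ 0 := fun h => by simpa using congrFun h 3
  have na₂ : (![0, 1, -1, 1, 1] : Fin 5 → F) ≠ 0 := fun h => by simpa using congrFun h 3
  have nb₁ : (![1, 0, -1, 1, -1] : Fin 5 → F) ≠ 0 := fun h => by simpa using congrFun h 0
  have nb₂ : (![1, 1, -1, 0, 1] : Fin 5 → F) ≠ 0 := fun h => by simpa using congrFun h 0
  have q1 : parabolicForm F ![0, 1, 0, 0, 0] = 0 := by simp [parabolicForm_apply]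
  have q2 : parabolicForm F ![0, 0, 1, 0, 0] = 0 := by simp [parabolicForm_apply]
  have q3 : parabolicForm F ![0, 0, 0, 1, 0] = 0 := by simp [parabolicForm_apply]
  have q4 : parabolicForm F ![0, 0, 0, 0, 1] = 0 := by simp [parabolicForm_apply]
  have qp₁ : parabolicForm F ![0, 1, 0, 0, 1] = 0 := by simp [parabolicForm_apply]
  have qp₂ : parabolicForm F ![0, 0, -1, 1, 0] = 0 := by simp [parabolicForm_apply]
  have qa₂ : parabolicForm F ![0, 1, -1, 1, 1] = 0 := by simp [parabolicForm_apply]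
  have qb₁ : parabolicForm F ![1, 0, -1, 1, -1] = 0 := by simp [parabolicForm_apply]
  have qb₂ : parabolicForm F ![1, 1, -1, 0, 1] = 0 := by simp [parabolicForm_apply]
  let l₀ : QLine F := mkLine ![0, 1, 0, 0, 0] ![0, 0, 0, 1, 0]
    ((LinearIndependent.pair_iff' n1).2 fun a h => by simpa using congrFun h 3) q1 q3
    (by simp [polarForm_apply])
  let l₁ : QLine F := mkLine ![0, 0, 1, 0, 0] ![0, 0, 0, 0, 1]
    ((LinearIndependent.pair_iff' n2).2 fun a h => by simpa using congrFun h 4) q2 q4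
    (by simp [polarForm_apply])
  let l₂ : QLine F := mkLine ![0, 1, 0, 0, 1] ![0, 0, -1, 1, 0]
    ((LinearIndependent.pair_iff' np₁).2 fun a h => by simpa using congrFun h 3) qp₁ qp₂
    (by simp [polarForm_apply])
  -- For `m₁` and `m₂`, the second spanning vector is singular, orthogonal to the first, and has X₀
  -- = 1, so the line leaves the section.
  let m₁ : QLine F := mkLine ![0, 1, 0, 0, 1] ![1, 0, -1, 1, -1]
    ((LinearIndependent.pair_iff' np₁).2 fun a h => by simpa using congrFun h 0) qp₁ qb₁
    (by simp [polarForm_apply])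
  let m₂ : QLine F := mkLine ![0, 0, -1, 1, 0] ![1, 1, -1, 0, 1]
    ((LinearIndependent.pair_iff' np₂).2 fun a h => by simpa using congrFun h 0) qp₂ qb₂
    (by simp [polarForm_apply])
  -- A transversal of the three skew lines: it meets them in ⟨e₁⟩, ⟨e₄⟩ and ⟨e₁ + e₄⟩, which serve
  -- as `a₀`, `a₁` and `p₁`.
  let n : QLine F := mkLine ![0, 1, 0, 0, 0] ![0, 0, 0, 0, 1]
    ((LinearIndependent.pair_iff' n1).2 fun a h => by simpa using congrFun h 4) q1 q4
    (by simp [polarForm_apply])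
  have e₀ : ∀ z, QInc z l₀ ↔ ∃ a b, z.vec = ![0, a, 0, b, 0] := fun z => by
    refine qInc_mkLine.trans (exists_congr fun a => exists_congr fun b => ?_)
    rw [eq_comm]
    simp
  have e₁ : ∀ z, QInc z l₁ ↔ ∃ a b, z.vec = ![0, 0, a, 0, b] := fun z => by
    refine qInc_mkLine.trans (exists_congr fun a => exists_congr fun b => ?_)
    rw [eq_comm]
    simp
  have e₂ : ∀ z, QInc z l₂ ↔ ∃ a b, z.vec = ![0, a, -b, b, a] := fun z => by
    refine qInc_mkLine.trans (exists_congr fun a => exists_congr fun b => ?_)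
    rw [eq_comm]
    simp
  have hfst : ∀ {x y : Fin 5 → F}, x ∈ Submodule.span F {x, y} := fun {x y} =>
    Submodule.subset_span (by simp)
  have hsnd : ∀ {x y : Fin 5 → F}, y ∈ Submodule.span F {x, y} := fun {x y} =>
    Submodule.subset_span (by simp)
  refine ⟨n, l₀, l₁, l₂, m₁, m₂, mkPoint _ np₁ qp₁, mkPoint _ np₂ qp₂, mkPoint _ n1 q1,
    mkPoint _ n4 q4, mkPoint _ na₂ qa₂, mkPoint _ nb₁ qb₁, mkPoint _ nb₂ qb₂, ?_, e₀, e₁, e₂⟩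
  exact
    { subspace := by
        intro p r l hne hp hr hp0 hr0 z hz
        rw [qInc_iff, QLine.eq_span hne hp hr] at hz
        obtain ⟨a, b, hab⟩ := Submodule.mem_span_pair.1 hz
        change p.vec 0 = 0 at hp0
        change r.vec 0 = 0 at hr0
        change z.vec 0 = 0
        rw [← hab, Pi.add_apply, Pi.smul_apply, Pi.smul_apply, hp0, hr0]
        simp
      l₀_subset := by
        intro z hz
        obtain ⟨a, b, h⟩ := (e₀ z).1 hz
        exact congrFun h 0
      l₁_subset := by
        intro z hz
        obtain ⟨a, b, h⟩ := (e₁ z).1 hz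
        exact congrFun h 0
      l₂_subset := by
        intro z hz
        obtain ⟨a, b, h⟩ := (e₂ z).1 hz
        exact congrFun h 0
      l₀_l₁ := by
        intro z hz hz'
        obtain ⟨a, b, h⟩ := (e₀ z).1 hz
        obtain ⟨a', b', h'⟩ := (e₁ z).1 hz'
        rw [h'] at h
        have h2 := congrFun h 2
        have h4 := congrFun h 4
        simp at h2 h4
        exact z.vec_ne_zero (by rw [h', h2, h4]; simp)
      l₀_l₂ := by
        intro z hz hz'
        obtain ⟨a, b, h⟩ := (e₀ z).1 hz
        obtain ⟨a', b', h'⟩ := (e₂ z).1 hz'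
        rw [h'] at h
        have h2 := congrFun h 2
        have h4 := congrFun h 4
        simp at h2 h4
        exact z.vec_ne_zero (by rw [h', h2, h4]; simp)
      l₁_l₂ := by
        intro z hz hz'
        obtain ⟨a, b, h⟩ := (e₁ z).1 hz
        obtain ⟨a', b', h'⟩ := (e₂ z).1 hz'
        rw [h'] at h
        have h1 := congrFun h 1
        have h3 := congrFun h 3
        simp at h1 h3
        exact z.vec_ne_zero (by rw [h', h1, h3]; simp)
      p₁_ne_p₂ := by
        rw [Ne, mkPoint_eq_iff]
        rintro ⟨c, hc⟩
        simpa using congrFun hc 1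
      p₁_l₂ := (qInc_mkPoint _ _).2 hfst
      p₂_l₂ := (qInc_mkPoint _ _).2 hsnd
      p₁_m₁ := (qInc_mkPoint _ _).2 hfst
      p₂_m₂ := (qInc_mkPoint _ _).2 hfst
      m₁_inter := by
        intro z hz hz0
        obtain ⟨a, b, hab⟩ := qInc_mkLine.1 hz
        have hb : b = 0 := by simpa using (congrFun hab 0).trans hz0
        exact eq_mkPoint_of_vec_eq_smul _ _ (by rw [← hab, hb, zero_smul, add_zero])
      m₂_inter := by
        intro z hz hz0
        obtain ⟨a, b, hab⟩ := qInc_mkLine.1 hz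
        have hb : b = 0 := by simpa using (congrFun hab 0).trans hz0
        exact eq_mkPoint_of_vec_eq_smul _ _ (by rw [← hab, hb, zero_smul, add_zero])
      a₀_l₀ := (qInc_mkPoint _ _).2 hfst
      a₁_l₁ := (qInc_mkPoint _ _).2 hsnd
      a₂_l₂ := (qInc_mkPoint _ _).2 (Submodule.mem_span_pair.2 ⟨1, 1, by simp⟩)
      b₁_m₁ := (qInc_mkPoint _ _).2 hsnd
      b₂_m₂ := (qInc_mkPoint _ _).2 hsnd
      a₂_ne_p₁ := by
        rw [Ne, mkPoint_eq_iff]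
        rintro ⟨c, hc⟩
        simpa using congrFun hc 3
      a₂_ne_p₂ := by
        rw [Ne, mkPoint_eq_iff]
        rintro ⟨c, hc⟩
        simpa using congrFun hc 1
      b₁_ne_p₁ := by
        rw [Ne, mkPoint_eq_iff]
        rintro ⟨c, hc⟩
        simpa using congrFun hc 0
      b₂_ne_p₂ := by
        rw [Ne, mkPoint_eq_iff]
        rintro ⟨c, hc⟩
        simpa using congrFun hc 0
      a₀_n := (qInc_mkPoint _ _).2 hfst
      a₁_n := (qInc_mkPoint _ _).2 hsnd
      p₁_n := (qInc_mkPoint _ _).2 (Submodule.mem_span_pair.2 ⟨1, 1, by simp⟩) }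

/-- Points collinear with two noncollinear points that have the same projections onto the three
lines of the configuration in the section `X₀ = 0` are in this section. -/
theorem vec_zero_of_common_collinear {l₀ l₁ l₂ : QLine F}
    (e₀ : ∀ z, QInc z l₀ ↔ ∃ a b, z.vec = ![0, a, 0, b, 0])
    (e₁ : ∀ z, QInc z l₁ ↔ ∃ a b, z.vec = ![0, 0, a, 0, b])
    (e₂ : ∀ z, QInc z l₂ ↔ ∃ a b, z.vec = ![0, a, -b, b, a])
    {x y : QPoint F} (hne : x ≠ y) (hxy : ¬ ∃ m, QInc x m ∧ QInc y m)
    (hx₀ : ¬ QInc x l₀) (hx₁ : ¬ QInc x l₁)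
    (h₀ : ∃ r, QInc r l₀ ∧ (∃ m, QInc x m ∧ QInc r m) ∧ ∃ m, QInc y m ∧ QInc r m)
    (h₁ : ∃ r, QInc r l₁ ∧ (∃ m, QInc x m ∧ QInc r m) ∧ ∃ m, QInc y m ∧ QInc r m)
    (h₂ : ∃ r, QInc r l₂ ∧ (∃ m, QInc x m ∧ QInc r m) ∧ ∃ m, QInc y m ∧ QInc r m)
    {s : QPoint F} (hxs : ∃ m, QInc x m ∧ QInc s m) (hys : ∃ m, QInc y m ∧ QInc s m) :
    s.vec 0 = 0 := by
  have orth : ∀ {p r : QPoint F}, (∃ m, QInc p m ∧ QInc r m) → polarForm p.vec r.vec = 0 :=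
    fun ⟨_, hp, hr⟩ => polarForm_eq_zero_of_qInc hp hr
  have hq := x.parabolicForm_vec
  rw [parabolicForm_apply] at hq
  -- If both coordinates vanish, the form reduces to X₀², so X₀ = 0 and `x` is on `l₀`; the case of
  -- `l₁` is symmetric.
  have hx24 : x.vec 2 ≠ 0 ∨ x.vec 4 ≠ 0 := by
    by_contra! h
    have h0 : x.vec 0 = 0 := by simpa [h.1, h.2] using hq
    exact hx₀ ((e₀ x).2 ⟨x.vec 1, x.vec 3, funext fun i => by
      fin_cases i; exacts [h0, rfl, h.1, rfl, h.2]⟩)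
  have hx13 : x.vec 1 ≠ 0 ∨ x.vec 3 ≠ 0 := by
    by_contra! h
    have h0 : x.vec 0 = 0 := by simpa [h.1, h.2] using hq
    exact hx₁ ((e₁ x).2 ⟨x.vec 2, x.vec 4, funext fun i => by
      fin_cases i; exacts [h0, h.1, rfl, h.2, rfl]⟩)
  obtain ⟨r₀, hr₀, hxr₀, hyr₀⟩ := h₀
  obtain ⟨r₁, hr₁, hxr₁, hyr₁⟩ := h₁
  obtain ⟨r₂, hr₂, hxr₂, hyr₂⟩ := h₂
  obtain ⟨a₀, b₀, f₀⟩ := (e₀ r₀).1 hr₀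
  obtain ⟨a₁, b₁, f₁⟩ := (e₁ r₁).1 hr₁
  obtain ⟨a₂, b₂, f₂⟩ := (e₂ r₂).1 hr₂
  have g₀ : a₀ ≠ 0 ∨ b₀ ≠ 0 := by
    by_contra! h
    exact r₀.vec_ne_zero (by rw [f₀, h.1, h.2]; simp)
  have g₁ : a₁ ≠ 0 ∨ b₁ ≠ 0 := by
    by_contra! h
    exact r₁.vec_ne_zero (by rw [f₁, h.1, h.2]; simp)
  have g₂ : a₂ ≠ 0 ∨ b₂ ≠ 0 := by
    by_contra! h
    exact r₂.vec_ne_zero (by rw [f₂, h.1, h.2]; simp)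
  exact zero_coord_of_common_collinear hne
    (fun h => hxy (exists_line_of_polarForm_eq_zero hne h)) hx24 hx13 g₀ g₁ g₂
    (f₀ ▸ orth hxr₀) (f₀ ▸ orth hyr₀) (f₁ ▸ orth hxr₁) (f₁ ▸ orth hyr₁)
    (f₂ ▸ orth hxr₂) (f₂ ▸ orth hyr₂) (orth hxs) (orth hys)

end Code

end GQCode

/-! ### Size bounds and assembly -/

theorem mainTheorem4 :
    ∃ c₁ c₂ : ℝ, 0 < c₁ ∧ 0 < c₂ ∧
      ∀ (q : ℕ), IsPrimePow q → ∀ (F : Type u) [Field F], Nat.card F = q →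
        -- the parabolic quadric is a generalized quadrangle with parameters (q, q)
        GQCode.IsGQ (GQCode.QInc (F := F)) q q ∧
        ∃ (W : Submodule F (Fin 5 → F)) (l₀ l₁ l₂ m₁ m₂ : GQCode.QLine F)
          (p₁ p₂ a₀ a₁ a₂ b₁ b₂ : GQCode.QPoint F) (C : Set (GQCode.QPoint F)),
          -- three pairwise skew lines of a hyperbolic section
          GQCode.IsHyperbolicHyperplane W ∧
          l₀.IsIn W ∧ l₁.IsIn W ∧ l₂.IsIn W ∧
          Disjoint l₀.points l₁.points ∧ Disjoint l₀.points l₂.points ∧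
          Disjoint l₁.points l₂.points ∧
          -- two further lines, through distinct points of the third, not in the section
          p₁ ≠ p₂ ∧ p₁ ∈ l₂.points ∧ p₂ ∈ l₂.points ∧
          p₁ ∈ m₁.points ∧ p₂ ∈ m₂.points ∧ ¬ m₁.IsIn W ∧ ¬ m₂.IsIn W ∧
          -- one point of each line, none of them on two of the lines
          a₀ ∈ l₀.points ∧ a₁ ∈ l₁.points ∧ a₂ ∈ l₂.points ∧ b₁ ∈ m₁.points ∧ b₂ ∈ m₂.points ∧
          a₂ ≠ p₁ ∧ a₂ ≠ p₂ ∧ b₁ ≠ p₁ ∧ b₂ ≠ p₂ ∧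
          -- the code
          C = (l₀.points ∪ l₁.points ∪ l₂.points ∪ m₁.points ∪ m₂.points) \
            {a₀, a₁, a₂, b₁, b₂} ∧
          GQCode.IsIdentifyingCode (GQCode.adjacencyGraph (GQCode.QInc (F := F))) C ∧
          C.ncard = 5 * q - 2 ∧
          -- its size is of order n ^ (1/3), where n is the number of vertices
          c₁ * (Nat.card (GQCode.QPoint F) : ℝ) ^ (1 / 3 : ℝ) ≤ (C.ncard : ℝ) ∧
          (C.ncard : ℝ) ≤ c₂ * (Nat.card (GQCode.QPoint F) : ℝ) ^ (1 / 3 : ℝ) := by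
  -- From q³ ≤ n ≤ (q + 1)³ ≤ (2q)³ the cube root of n lies between q and 2q, while 2q ≤ 5q - 2 ≤
  -- 5q.
  refine ⟨1, 5, one_pos, by norm_num, ?_⟩
  intro q hq F _ hF
  have hq2 : 2 ≤ q := hq.two_le
  have : Finite F := Nat.finite_of_card_ne_zero (by omega)
  have hG : GQCode.IsGQ (GQCode.QInc (F := F)) q q := hF ▸ GQCode.isGQ_qInc
  obtain ⟨n, l₀, l₁, l₂, m₁, m₂, p₁, p₂, a₀, a₁, a₂, b₁, b₂, h, e₀, e₁, e₂⟩ :=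
    GQCode.exists_isCodeConfiguration (F := F)
  have hin : ∀ {l : GQCode.QLine F}, (∀ z, GQCode.QInc z l → z.vec 0 = 0) →
      l.IsIn (LinearMap.ker (LinearMap.proj 0 : (Fin 5 → F) →ₗ[F] F)) := by
    intro l hl x hx
    by_cases hx0 : x = 0
    · simp [hx0]
    · obtain ⟨c, hc, hv⟩ := GQCode.vec_mkPoint x hx0 (l.2.2 x hx)
      have h0 := hl _ ((GQCode.qInc_mkPoint hx0 (l.2.2 x hx)).2 hx)
      rw [hv, Pi.smul_apply, smul_eq_mul, mul_eq_zero] at h0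
      exact LinearMap.mem_ker.2 (h0.resolve_left hc)
  have hcard := h.ncard_codeOf hG
  have hlow : (q : ℝ) ^ 3 ≤ Nat.card (GQCode.QPoint F) := by
    have := GQCode.card_pow_three_le_card_qPoint (F := F)
    rw [hF] at this
    exact_mod_cast this
  have hupp : (Nat.card (GQCode.QPoint F) : ℝ) ≤ (2 * q) ^ 3 := by
    have h1 := hG.card_points_le l₀
    have h2 : (q + 1) * ((q + 1) * (q + 1)) ≤ (2 * q) * ((2 * q) * (2 * q)) := by
      gcongr <;> omega
    calc (Nat.card (GQCode.QPoint F) : ℝ) ≤ ((2 * q) * ((2 * q) * (2 * q)) : ℕ) := by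
          exact_mod_cast h1.trans h2
      _ = (2 * q) ^ 3 := by push_cast; ring
  have root : ∀ {a : ℝ}, 0 ≤ a → (a ^ 3) ^ (1 / 3 : ℝ) = a := fun {a} ha => by
    rw [← Real.rpow_natCast, ← Real.rpow_mul ha]
    norm_num
  have hq0 : (0 : ℝ) ≤ q := q.cast_nonneg
  have hqr : (2 : ℝ) ≤ q := by exact_mod_cast hq2
  have hlow' := Real.rpow_le_rpow (by positivity) hlow (by norm_num : (0 : ℝ) ≤ 1 / 3)
  have hupp' := Real.rpow_le_rpow (by positivity) hupp (by norm_num : (0 : ℝ) ≤ 1 / 3)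
  rw [root hq0] at hlow'
  rw [root (by positivity)] at hupp'
  have hcast : ((5 * q - 2 : ℕ) : ℝ) = 5 * q - 2 := by
    rw [Nat.cast_sub (by omega)]
    push_cast
    ring
  refine ⟨hG, LinearMap.ker (LinearMap.proj 0), l₀, l₁, l₂, m₁, m₂, p₁, p₂, a₀, a₁, a₂, b₁, b₂,
    GQCode.codeOf GQCode.QInc l₀ l₁ l₂ m₁ m₂ a₀ a₁ a₂ b₁ b₂,
    GQCode.isHyperbolicHyperplane_ker_proj_zero, hin h.l₀_subset, hin h.l₁_subset,
    hin h.l₂_subset, Set.disjoint_left.2 h.l₀_l₁, Set.disjoint_left.2 h.l₀_l₂,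
    Set.disjoint_left.2 h.l₁_l₂, h.p₁_ne_p₂, h.p₁_l₂, h.p₂_l₂, h.p₁_m₁, h.p₂_m₂, ?_, ?_,
    h.a₀_l₀, h.a₁_l₁, h.a₂_l₂, h.b₁_m₁, h.b₂_m₂, h.a₂_ne_p₁, h.a₂_ne_p₂, h.b₁_ne_p₁, h.b₂_ne_p₂,
    rfl, ⟨h.dominating hG, fun x y hne => h.separating hG hq2 ?_ hne⟩, hcard, ?_, ?_⟩
  -- The removed point, being different from `p₁`, witnesses that the line is not in the section.
  · exact fun hm => h.b₁_ne_p₁ (h.m₁_inter b₁ h.b₁_m₁ (hm (GQCode.qInc_iff.1 h.b₁_m₁)))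
  · exact fun hm => h.b₂_ne_p₂ (h.m₂_inter b₂ h.b₂_m₂ (hm (GQCode.qInc_iff.1 h.b₂_m₂)))
  · intro x y hne hxy hx₀ hx₁ h₀ h₁ h₂ s hxs hys
    exact GQCode.vec_zero_of_common_collinear e₀ e₁ e₂ hne hxy hx₀ hx₁ h₀ h₁ h₂ hxs hys
  · rw [hcard, hcast]
    linarith
  · rw [hcard, hcast]
    linarith
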